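/- Let $\mathcal V\subseteq\mathbf{Cat}$ be a full sub-2-category of the 2-category of small categories which is closed under small limits and exponentials, has small colimits and contains the arrow category $\mathbf 2$. Let $\mathcal C$ be a cocomplete $\mathcal V$-category (all small weighted colimits exist) with a terminal object $1$, and suppose that its underlying category is locally ranked with respect to a proper orthogonal factorisation system $(\mathcal E,\mathcal M)$: the underlying category is cocomplete, every morphism of $\mathcal E$ is epi and every morphism of $\mathcal M$ is mono, each object has, up to isomorphism, only a small set of $\mathcal E$-morphisms out of it, and every object has a rank. Here a diagram $(X_j)_{j\in J}$ is called a diagram of $\mathcal M$-subobjects if it admits a cocone $(X_j\to Y)_{j\in J}$ all of whose components lie in $\mathcal M$; an object $X$ has rank if there is a regular cardinal $\kappa$ such that $\mathcal C(X,-)\colon\mathcal C\to\mathbf{Set}$ preserves the colimit of every small $\kappa$-filtered diagram of $\mathcal M$-subobjects; and a morphism of $\mathcal C$ has rank if it has rank as an object of $\mathcal C^{\mathbf 2}$ with respect to the class of morphisms of $\mathcal C^{\mathbf 2}$ whose two components lie in $\mathcal M$. Let $(\mathsf L,\mathsf R)$ be a $\mathcal V$-enriched algebraic weak factorisation system on $\mathcal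 C$. Its underlying weak factorisation system $(\mathcal L,\mathcal R)$ consists of the class $\mathcal L$ of morphisms that admit a coalgebra structure for the underlying copointed endofunctor of $\mathsf L$ and the class $\mathcal R$ of morphisms that admit an algebra structure for the underlying pointed endofunctor of $\mathsf R$. The fibrant replacement monad $\mathsf R_1$ is the restriction of $\mathsf R$ to $\mathcal C/1\cong\mathcal C$, and an object $X$ is fibrant for $(\mathcal L,\mathcal R)$ if $X\to 1$ lies in $\mathcal R$. Suppose that $(\mathcal L,\mathcal R)$ is cofibrantly generated by a small set $\mathcal I$ of morphisms with rank; that is, $\mathcal R$ is the class of morphisms with the right lifting property with respect to every member of $\mathcal I$, and $\mathcal L$ is the class of morphisms with the left lifting property with respect to every member of $\mathcal R$. Then there is a regular cardinal $\kappa$ such that, for every small $\kappa$-filtered category $J$ and every diagram $J\to\mathsf R_1\text{-}\mathrm{Alg}$ whose underlying diagram $(X_j)_{j\in J}$ in $\mathcal C$ is a diagram of $\mathcal M$-subobjects, the colimit $\operatorname{colim}_j X_j$ in $\mathcal C$ is a fibrant object for $(\mathcal L,\mathcal R)$. -/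

import Mathlib

open CategoryTheory Category MonoidalCategory Limits

universe w v' v₁ v₂ v u' u₁ u₂ u

noncomputable section

/-! ### The base of enrichment -/

/-- A full sub-2-category `𝒱 ⊆ Cat` (given by a property of small categories) suitable as a base of
enrichment: it is closed under small limits and under exponentials (functor categories), it
contains the arrow category `𝟚`, and it has small colimits.
(The colimits of `𝒱` are not required to be computed in `Cat`; for preorders and
posets they are not.) -/
class IsEnrichmentBase (P : ObjectProperty Cat.{v, v}) : Prop where
  closedUnderLimits (J : Type v) [SmallCategory J] : P.IsClosedUnderLimitsOfShape J
  hasColimits : HasColimitsOfSize.{v, v} P.FullSubcategory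
  exponential (X Y : Cat.{v, v}) : P X → P Y → P (Cat.of (X ⥤ Y))
  arrow : P (Cat.of (ULift.{v} (Fin 2)))

namespace IsEnrichmentBase

variable (P : ObjectProperty Cat.{v, v}) [IsEnrichmentBase P]

instance (J : Type v) [SmallCategory J] : P.IsClosedUnderLimitsOfShape J :=
  closedUnderLimits J

instance : P.IsMonoidal where
  prop_unit := by
    have h : P.IsClosedUnderLimitsOfShape (Discrete PEmpty.{v + 1}) := closedUnderLimits _
    refine h.limitsOfShape_le _ ⟨?_⟩
    exact
      { diag := Functor.empty _
        π := { app := fun j ↦ j.as.elim, naturality := fun j ↦ j.as.elim }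
        isLimit :=
          { lift := fun s ↦ Cat.chosenTerminalIsTerminal.from s.pt
            fac := fun _ j ↦ j.as.elim
            uniq := fun s m _ ↦ Cat.chosenTerminalIsTerminal.hom_ext _ _ }
        prop_diag_obj := fun j ↦ j.as.elim }
  prop_tensor X Y hX hY := by
    have h : P.IsClosedUnderLimitsOfShape (Discrete (ULift.{v} WalkingPair)) :=
      closedUnderLimits _
    have h' : P.IsClosedUnderLimitsOfShape (Discrete WalkingPair) :=
      ObjectProperty.IsClosedUnderLimitsOfShape.of_equivalence
        (Discrete.equivalence Equiv.ulift)
    refine h'.limitsOfShape_le _ ⟨?_⟩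
    exact
      { diag := pair X Y
        π := (Cat.prodCone X Y).π
        isLimit := Cat.isLimitProdCone X Y
        prop_diag_obj := by rintro ⟨_ | _⟩ <;> assumption }

instance : HasLimitsOfSize.{v, v} P.FullSubcategory where
  has_limits_of_shape _ _ := inferInstance

end IsEnrichmentBase

/-! ### Enriched functors, enriched natural transformations, the enriched arrow category -/

section Enriched

variable (V : Type u') [Category.{v'} V] [MonoidalCategory V]
variable {C : Type u} [Category.{v} C] [EnrichedOrdinaryCategory V C]
variable {D : Type u₁} [Category.{v₁} D] [EnrichedOrdinaryCategory V D]
variable {E : Type u₂} [Category.{v₂} E] [EnrichedOrdinaryCategory V E]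

/-- The structure of a `V`-functor on an ordinary functor `F` between the underlying categories of
two `V`-categories: a functorial action on hom-objects that induces the action of `F` on
morphisms. -/
structure FunctorEnrichment (F : C ⥤ D) where
  map (X Y : C) : (X ⟶[V] Y) ⟶ (F.obj X ⟶[V] F.obj Y)
  map_id (X : C) : eId V X ≫ map X X = eId V (F.obj X)
  map_comp (X Y Z : C) :
    eComp V X Y Z ≫ map X Z = (map X Y ⊗ₘ map Y Z) ≫ eComp V (F.obj X) (F.obj Y) (F.obj Z)
  map_homEquiv {X Y : C} (f : X ⟶ Y) : eHomEquiv V f ≫ map X Y = eHomEquiv V (F.map f)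

namespace FunctorEnrichment

variable {V}

lemma map_whiskerLeft {F : C ⥤ D} (e : FunctorEnrichment V F) (X : C) {Y Z : C} (g : Y ⟶ Z) :
    eHomWhiskerLeft V X g ≫ e.map X Z = e.map X Y ≫ eHomWhiskerLeft V (F.obj X) (F.map g) := by
  simp only [eHomWhiskerLeft, assoc, e.map_comp, ← e.map_homEquiv, MonoidalCategory.tensorHom_def,
    MonoidalCategory.whiskerLeft_comp]
  rw [whisker_exchange_assoc, MonoidalCategory.whiskerRight_id_assoc]
  simp

lemma map_whiskerRight {F : C ⥤ D} (e : FunctorEnrichment V F) {X Y : C} (f : X ⟶ Y) (Z : C) :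
    eHomWhiskerRight V f Z ≫ e.map X Z = e.map Y Z ≫ eHomWhiskerRight V (F.map f) (F.obj Z) := by
  simp only [eHomWhiskerRight, assoc, e.map_comp, ← e.map_homEquiv, tensorHom_def',
    MonoidalCategory.comp_whiskerRight]
  rw [← whisker_exchange_assoc, MonoidalCategory.id_whiskerLeft_assoc]
  simp

variable (V C) in
/-- The identity `V`-functor. -/
def id : FunctorEnrichment V (𝟭 C) where
  map X Y := 𝟙 _
  map_id := by simp
  map_comp := by simp
  map_homEquiv := by simp

/-- The composition of `V`-functors. -/
def comp {F : C ⥤ D} {G : D ⥤ E} (eF : FunctorEnrichment V F) (eG : FunctorEnrichment V G) :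
    FunctorEnrichment V (F ⋙ G) where
  map X Y := eF.map X Y ≫ eG.map (F.obj X) (F.obj Y)
  map_id X := by rw [← assoc, eF.map_id, eG.map_id]; rfl
  map_comp X Y Z := by
    rw [← assoc, eF.map_comp, assoc, eG.map_comp, ← assoc, tensorHom_comp_tensorHom]; rfl
  map_homEquiv f := by rw [← assoc, eF.map_homEquiv, eG.map_homEquiv]; rfl

/-- An ordinary natural transformation between (the underlying functors of) `V`-functors
is `V`-natural. -/
def IsNatural {F G : C ⥤ D} (eF : FunctorEnrichment V F) (eG : FunctorEnrichment V G)
    (α : F ⟶ G) : Prop :=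
  ∀ X Y : C, eF.map X Y ≫ eHomWhiskerLeft V (F.obj X) (α.app Y) =
    eG.map X Y ≫ eHomWhiskerRight V (α.app X) (G.obj Y)

end FunctorEnrichment

lemma eHomWhisker_middle (X : C) {Y Y' : C} (g : Y ⟶ Y') (Z : C) :
    (eHomWhiskerLeft V X g ▷ (Y' ⟶[V] Z)) ≫ eComp V X Y' Z =
      ((X ⟶[V] Y) ◁ eHomWhiskerRight V g Z) ≫ eComp V X Y Z := by
  simp [eHomWhiskerLeft, eHomWhiskerRight]

lemma eHomEquiv_whiskerLeft {X Y Z : C} (f : X ⟶ Y) (g : Y ⟶ Z) :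
    eHomEquiv V f ≫ eHomWhiskerLeft V X g = eHomEquiv V (f ≫ g) := by
  rw [eHomEquiv_comp, eHomWhiskerLeft, MonoidalCategory.tensorHom_def_assoc,
    MonoidalCategory.whiskerRight_id_assoc, ← unitors_equal]
  simp

lemma eHomEquiv_whiskerRight {X Y Z : C} (f : X ⟶ Y) (g : Y ⟶ Z) :
    eHomEquiv V g ≫ eHomWhiskerRight V f Z = eHomEquiv V (f ≫ g) := by
  rw [eHomEquiv_comp, eHomWhiskerRight, tensorHom_def'_assoc, id_whiskerLeft_assoc]
  simp

variable [HasPullbacks V]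

/-- The hom-object `C^𝟚(f, g)` of commutative squares from `f` to `g`: the pullback of
`C(dom f, dom g) ⟶ C(dom f, cod g) ⟵ C(cod f, cod g)`. -/
def arrowHom (f g : Arrow C) : V :=
  pullback (eHomWhiskerLeft V f.left g.hom) (eHomWhiskerRight V f.hom g.right)

/-- The projection `C^𝟚(f, g) ⟶ C(dom f, dom g)`. -/
def arrowFst (f g : Arrow C) : arrowHom V f g ⟶ (f.left ⟶[V] g.left) :=
  pullback.fst (eHomWhiskerLeft V f.left g.hom) (eHomWhiskerRight V f.hom g.right)

/-- The projection `C^𝟚(f, g) ⟶ C(cod f, cod g)`. -/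
def arrowSnd (f g : Arrow C) : arrowHom V f g ⟶ (f.right ⟶[V] g.right) :=
  pullback.snd (eHomWhiskerLeft V f.left g.hom) (eHomWhiskerRight V f.hom g.right)

lemma arrow_condition (f g : Arrow C) :
    arrowFst V f g ≫ eHomWhiskerLeft V f.left g.hom =
      arrowSnd V f g ≫ eHomWhiskerRight V f.hom g.right :=
  pullback.condition

variable {V} in
lemma arrow_hom_ext {W : V} {f g : Arrow C} {a b : W ⟶ arrowHom V f g}
    (h₁ : a ≫ arrowFst V f g = b ≫ arrowFst V f g)
    (h₂ : a ≫ arrowSnd V f g = b ≫ arrowSnd V f g) : a = b :=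
  pullback.hom_ext h₁ h₂

variable {V} in
/-- The universal property of `C^𝟚(f, g)`. -/
def arrowLift {W : V} {f g : Arrow C} (a : W ⟶ (f.left ⟶[V] g.left))
    (b : W ⟶ (f.right ⟶[V] g.right))
    (h : a ≫ eHomWhiskerLeft V f.left g.hom = b ≫ eHomWhiskerRight V f.hom g.right) :
    W ⟶ arrowHom V f g :=
  pullback.lift a b h

@[simp]
lemma arrowLift_fst {W : V} {f g : Arrow C} (a : W ⟶ (f.left ⟶[V] g.left))
    (b : W ⟶ (f.right ⟶[V] g.right))
    (h : a ≫ eHomWhiskerLeft V f.left g.hom = b ≫ eHomWhiskerRight V f.hom g.right) :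
    arrowLift a b h ≫ arrowFst V f g = a :=
  pullback.lift_fst _ _ _

@[simp]
lemma arrowLift_snd {W : V} {f g : Arrow C} (a : W ⟶ (f.left ⟶[V] g.left))
    (b : W ⟶ (f.right ⟶[V] g.right))
    (h : a ≫ eHomWhiskerLeft V f.left g.hom = b ≫ eHomWhiskerRight V f.hom g.right) :
    arrowLift a b h ≫ arrowSnd V f g = b :=
  pullback.lift_snd _ _ _

/-- The composition of `C^𝟚`. -/
def arrowComp (f g h : Arrow C) : arrowHom V f g ⊗ arrowHom V g h ⟶ arrowHom V f h :=
  arrowLift ((arrowFst V f g ⊗ₘ arrowFst V g h) ≫ eComp V f.left g.left h.left)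
    ((arrowSnd V f g ⊗ₘ arrowSnd V g h) ≫ eComp V f.right g.right h.right) (by
      erw [assoc, assoc, eComp_eHomWhiskerLeft, eComp_eHomWhiskerRight,
        MonoidalCategory.tensorHom_def_assoc,
        ← MonoidalCategory.whiskerLeft_comp_assoc, arrow_condition,
        MonoidalCategory.whiskerLeft_comp_assoc, ← eHomWhisker_middle,
        ← MonoidalCategory.tensorHom_def_assoc,
        tensorHom_def'_assoc, ← comp_whiskerRight_assoc, arrow_condition,
        comp_whiskerRight_assoc, ← tensorHom_def'_assoc])

@[simp]
lemma arrowComp_fst (f g h : Arrow C) :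
    arrowComp V f g h ≫ arrowFst V f h =
      (arrowFst V f g ⊗ₘ arrowFst V g h) ≫ eComp V f.left g.left h.left :=
  arrowLift_fst _ _ _ _

@[simp]
lemma arrowComp_snd (f g h : Arrow C) :
    arrowComp V f g h ≫ arrowSnd V f h =
      (arrowSnd V f g ⊗ₘ arrowSnd V g h) ≫ eComp V f.right g.right h.right :=
  arrowLift_snd _ _ _ _

/-- Commutative squares are the elements of the hom-object `C^𝟚(f, g)`. -/
def arrowHomEquiv (f g : Arrow C) : (f ⟶ g) ≃ (𝟙_ V ⟶ arrowHom V f g) where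
  toFun φ := arrowLift (eHomEquiv V φ.left) (eHomEquiv V φ.right)
    (by
      refine (eHomEquiv_whiskerLeft V φ.left g.hom).trans ?_
      refine Eq.trans ?_ (eHomEquiv_whiskerRight V f.hom φ.right).symm
      exact congrArg _ (Arrow.w φ))
  invFun x := Arrow.homMk ((eHomEquiv V).symm (x ≫ arrowFst V f g))
    ((eHomEquiv V).symm (x ≫ arrowSnd V f g)) (by
      apply (eHomEquiv V).injective
      refine (eHomEquiv_whiskerLeft V _ g.hom).symm.trans ?_
      refine Eq.trans ?_ (eHomEquiv_whiskerRight V f.hom _)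
      rw [Equiv.apply_symm_apply, Equiv.apply_symm_apply]
      refine (assoc _ _ _).trans ?_
      refine Eq.trans ?_ (assoc _ _ _).symm
      exact congrArg _ (arrow_condition V f g))
  left_inv φ := by ext <;> simp
  right_inv x := by apply arrow_hom_ext <;> simp

@[simp]
lemma arrowHomEquiv_fst {f g : Arrow C} (φ : f ⟶ g) :
    arrowHomEquiv V f g φ ≫ arrowFst V f g = eHomEquiv V φ.left :=
  arrowLift_fst _ _ _ _

@[simp]
lemma arrowHomEquiv_snd {f g : Arrow C} (φ : f ⟶ g) :
    arrowHomEquiv V f g φ ≫ arrowSnd V f g = eHomEquiv V φ.right :=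
  arrowLift_snd _ _ _ _

/-- The `V`-category `C^𝟚` of arrows of a `V`-category `C`. -/
instance arrowEnriched : EnrichedOrdinaryCategory V (Arrow C) where
  Hom f g := arrowHom V f g
  id f := arrowHomEquiv V f f (𝟙 f)
  comp f g h := arrowComp V f g h
  id_comp f g := by
    apply arrow_hom_ext
    · simp only [assoc, arrowComp_fst, tensorHom_def', ← comp_whiskerRight_assoc,
        whisker_exchange_assoc, arrowHomEquiv_fst, Arrow.id_left, eHomEquiv_id]
      rw [← whisker_exchange_assoc]
      simp
    · simp only [assoc, arrowComp_snd, tensorHom_def', ← comp_whiskerRight_assoc,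
        whisker_exchange_assoc, arrowHomEquiv_snd, Arrow.id_right, eHomEquiv_id]
      rw [← whisker_exchange_assoc]
      simp
  comp_id f g := by
    apply arrow_hom_ext
    · simp only [assoc, arrowComp_fst, MonoidalCategory.tensorHom_def,
        ← MonoidalCategory.whiskerLeft_comp_assoc,
        ← whisker_exchange_assoc, arrowHomEquiv_fst, Arrow.id_left, eHomEquiv_id]
      rw [whisker_exchange_assoc]
      simp
    · simp only [assoc, arrowComp_snd, MonoidalCategory.tensorHom_def,
        ← MonoidalCategory.whiskerLeft_comp_assoc,
        ← whisker_exchange_assoc, arrowHomEquiv_snd, Arrow.id_right, eHomEquiv_id]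
      rw [whisker_exchange_assoc]
      simp
  assoc f g h k := by
    apply arrow_hom_ext
    · conv_lhs =>
        rw [assoc, assoc, arrowComp_fst, MonoidalCategory.tensorHom_def_assoc,
          ← comp_whiskerRight_assoc, arrowComp_fst, comp_whiskerRight_assoc,
          ← whisker_exchange_assoc, ← whisker_exchange_assoc, ← tensorHom_def'_assoc,
          ← associator_inv_naturality_assoc]
      conv_rhs =>
        rw [assoc, arrowComp_fst, tensorHom_def'_assoc, ← MonoidalCategory.whiskerLeft_comp_assoc,
          arrowComp_fst, MonoidalCategory.whiskerLeft_comp_assoc, whisker_exchange_assoc,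
          whisker_exchange_assoc, ← MonoidalCategory.tensorHom_def_assoc]
      rw [e_assoc]
    · conv_lhs =>
        rw [assoc, assoc, arrowComp_snd, MonoidalCategory.tensorHom_def_assoc,
          ← comp_whiskerRight_assoc, arrowComp_snd, comp_whiskerRight_assoc,
          ← whisker_exchange_assoc, ← whisker_exchange_assoc, ← tensorHom_def'_assoc,
          ← associator_inv_naturality_assoc]
      conv_rhs =>
        rw [assoc, arrowComp_snd, tensorHom_def'_assoc, ← MonoidalCategory.whiskerLeft_comp_assoc,
          arrowComp_snd, MonoidalCategory.whiskerLeft_comp_assoc, whisker_exchange_assoc,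
          whisker_exchange_assoc, ← MonoidalCategory.tensorHom_def_assoc]
      rw [e_assoc]
  homEquiv := arrowHomEquiv V _ _
  homEquiv_id _ := rfl
  homEquiv_comp {f g h} φ ψ := by
    change arrowHomEquiv V f h (φ ≫ ψ) = (λ_ _).inv ≫
      (arrowHomEquiv V f g φ ⊗ₘ arrowHomEquiv V g h ψ) ≫ arrowComp V f g h
    apply arrow_hom_ext
    · rw [assoc, assoc, arrowComp_fst, tensorHom_comp_tensorHom_assoc, arrowHomEquiv_fst,
        arrowHomEquiv_fst, arrowHomEquiv_fst]
      exact eHomEquiv_comp V φ.left ψ.left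
    · rw [assoc, assoc, arrowComp_snd, tensorHom_comp_tensorHom_assoc, arrowHomEquiv_snd,
        arrowHomEquiv_snd, arrowHomEquiv_snd]
      exact eHomEquiv_comp V φ.right ψ.right

/-- The domain `V`-functor `C^𝟚 ⟶ C`. -/
def domEnrichment : FunctorEnrichment V (Arrow.leftFunc : Arrow C ⥤ C) where
  map f g := arrowFst V f g
  map_id f := (arrowHomEquiv_fst V (𝟙 f)).trans (eHomEquiv_id V f.left)
  map_comp f g h := arrowComp_fst V f g h
  map_homEquiv φ := arrowHomEquiv_fst V φ

/-- The codomain `V`-functor `C^𝟚 ⟶ C`. -/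
def codEnrichment : FunctorEnrichment V (Arrow.rightFunc : Arrow C ⥤ C) where
  map f g := arrowSnd V f g
  map_id f := (arrowHomEquiv_snd V (𝟙 f)).trans (eHomEquiv_id V f.right)
  map_comp f g h := arrowComp_snd V f g h
  map_homEquiv φ := arrowHomEquiv_snd V φ

variable {V} in
/-- The functor `D ⥤ C^𝟚` determined by a natural transformation `F ⟶ G` of functors `D ⥤ C`. -/
def toArrow {F G : D ⥤ C} (α : F ⟶ G) : D ⥤ Arrow C where
  obj X := Arrow.mk (α.app X)
  map φ := Arrow.homMk (F.map φ) (G.map φ)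

variable {V} in
/-- If `α : F ⟶ G` is `V`-natural, then the corresponding functor `D ⥤ C^𝟚` is a `V`-functor. -/
def toArrowEnrichment {F G : D ⥤ C} (eF : FunctorEnrichment V F) (eG : FunctorEnrichment V G)
    (α : F ⟶ G) (h : eF.IsNatural eG α) : FunctorEnrichment V (toArrow α) :=
  let m (X Y : D) : (X ⟶[V] Y) ⟶ arrowHom V (Arrow.mk (α.app X)) (Arrow.mk (α.app Y)) :=
    arrowLift (f := Arrow.mk (α.app X)) (g := Arrow.mk (α.app Y))
      (eF.map X Y) (eG.map X Y) (h X Y)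
  have m₁ (X Y : D) : m X Y ≫ arrowFst V _ _ = eF.map X Y := arrowLift_fst V _ _ (h X Y)
  have m₂ (X Y : D) : m X Y ≫ arrowSnd V _ _ = eG.map X Y := arrowLift_snd V _ _ (h X Y)
  { map := m
    map_id := fun X ↦ by
      change eId V X ≫ m X X = arrowHomEquiv V _ _ (𝟙 (Arrow.mk (α.app X)))
      apply arrow_hom_ext
      · rw [assoc, m₁, eF.map_id, arrowHomEquiv_fst]
        exact (eHomEquiv_id V (F.obj X)).symm
      · rw [assoc, m₂, eG.map_id, arrowHomEquiv_snd]
        exact (eHomEquiv_id V (G.obj X)).symm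
    map_comp := fun X Y Z ↦ by
      change eComp V X Y Z ≫ m X Z = (m X Y ⊗ₘ m Y Z) ≫ arrowComp V (Arrow.mk (α.app X))
        (Arrow.mk (α.app Y)) (Arrow.mk (α.app Z))
      apply arrow_hom_ext
      · rw [assoc, m₁, eF.map_comp, assoc, arrowComp_fst, tensorHom_comp_tensorHom_assoc, m₁, m₁]
        rfl
      · rw [assoc, m₂, eG.map_comp, assoc, arrowComp_snd, tensorHom_comp_tensorHom_assoc, m₂, m₂]
        rfl
    map_homEquiv := fun {X Y} f ↦ by
      change eHomEquiv V f ≫ m X Y = arrowHomEquiv V _ _ ((toArrow α).map f)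
      apply arrow_hom_ext
      · rw [assoc, m₁, eF.map_homEquiv]
        exact (arrowHomEquiv_fst V ((toArrow α).map f)).symm
      · rw [assoc, m₂, eG.map_homEquiv]
        exact (arrowHomEquiv_snd V ((toArrow α).map f)).symm }

end Enriched

/-! ### Cocomplete enriched categories -/

section Cocomplete

variable (V : Type u') [Category.{v'} V] [MonoidalCategory V]

/-- A `V`-presheaf on a `V`-category `D` (a `V`-functor `Dᵒᵖ ⟶ V`), presented by its contravariant
action. -/
structure EnrichedPresheaf (D : Type w) [EnrichedCategory V D] where
  obj : D → V
  act (a b : D) : (a ⟶[V] b) ⊗ obj b ⟶ obj a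
  id_act (a : D) : (λ_ (obj a)).inv ≫ eId V a ▷ obj a ≫ act a a = 𝟙 (obj a)
  comp_act (a b c : D) :
    (α_ (a ⟶[V] b) (b ⟶[V] c) (obj c)).inv ≫ eComp V a b c ▷ obj c ≫ act a c =
      (a ⟶[V] b) ◁ act b c ≫ act a b

variable {V}
variable {C : Type u} [EnrichedCategory V C] {D : Type w} [EnrichedCategory V D]

/-- A `W`-weighted cylinder from the `V`-functor `G` to the object `x`, parametrised by `T : V`:
a `V`-natural family of morphisms `W d ⊗ T ⟶ C(G d, x)`. -/
structure WeightedCylinder (W : EnrichedPresheaf V D) (G : EnrichedFunctor V D C) (x : C)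
    (T : V) where
  app (d : D) : W.obj d ⊗ T ⟶ (G.obj d ⟶[V] x)
  naturality (a b : D) :
    (α_ (a ⟶[V] b) (W.obj b) T).inv ≫ W.act a b ▷ T ≫ app a =
      (G.map a b ⊗ₘ app b) ≫ eComp V (G.obj a) (G.obj b) x

/-- The object `c`, with the `V`-natural family `η d : W d ⟶ C(G d, c)`, is a colimit of the
`V`-functor `G` weighted by the `V`-presheaf `W`: composition with `η` exhibits `C(c, x)` as the
object of `V`-natural transformations from `W` to `C(G -, x)`. -/
structure IsWeightedColimit (W : EnrichedPresheaf V D) (G : EnrichedFunctor V D C) (c : C)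
    (η : ∀ d : D, W.obj d ⟶ (G.obj d ⟶[V] c)) : Prop where
  naturality (a b : D) :
    W.act a b ≫ η a = (G.map a b ⊗ₘ η b) ≫ eComp V (G.obj a) (G.obj b) c
  existsUnique (x : C) (T : V) (τ : WeightedCylinder W G x T) :
    ∃! f : T ⟶ (c ⟶[V] x), ∀ d : D, (η d ⊗ₘ f) ≫ eComp V (G.obj d) c x = τ.app d

variable (V) (C) in
/-- The `V`-category `C` is cocomplete: it has all colimits weighted by `V`-presheaves on `V`-categories
with a `w`-small set of objects. -/
def IsEnrichedCocomplete : Prop :=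
  ∀ (D : Type w) [EnrichedCategory V D] (W : EnrichedPresheaf V D) (G : EnrichedFunctor V D C),
    ∃ (c : C) (η : ∀ d : D, W.obj d ⟶ (G.obj d ⟶[V] c)), IsWeightedColimit W G c η

end Cocomplete

/-! ### Orthogonal factorisation systems, rank, locally ranked categories -/

section LocallyRanked

variable {A : Type u} [Category.{v} A]

/-- An orthogonal factorisation system: a weak factorisation system whose diagonal fillers are
unique. -/
structure IsOFS (E M : MorphismProperty A) : Prop where
  wfs : MorphismProperty.IsWeakFactorizationSystem E M
  unique {X Y Z T : A} (e : X ⟶ Y) (m : Z ⟶ T) (_ : E e) (_ : M m) (d d' : Y ⟶ Z) :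
    e ≫ d = e ≫ d' → d ≫ m = d' ≫ m → d = d'

/-- The factorisation system `(E, M)` is proper: `E` consists of epimorphisms and `M` of
monomorphisms. -/
structure IsProperOFS (E M : MorphismProperty A) : Prop extends IsOFS E M where
  epi : E ≤ MorphismProperty.epimorphisms A
  mono : M ≤ MorphismProperty.monomorphisms A

/-- Each object is the domain of only a small set of morphisms in `E`, up to isomorphism. -/
def IsCowellpowered (E : MorphismProperty A) : Prop :=
  ∀ X : A, ∃ (S : Type v) (Q : S → A) (q : ∀ s, X ⟶ Q s), (∀ s, E (q s)) ∧
    ∀ (Y : A) (e : X ⟶ Y), E e → ∃ (s : S) (i : Q s ≅ Y), q s ≫ i.hom = e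

/-- The diagram `F` is a diagram of `M`-subobjects of some object: it has a cocone (not
necessarily a colimit) whose components are in `M`. -/
def IsDiagramOfSubobjects (M : MorphismProperty A) {J : Type w} [Category.{v'} J]
    (F : J ⥤ A) : Prop :=
  ∃ s : Cocone F, ∀ j, M (s.ι.app j)

/-- The object `X` has rank less or equal to the regular cardinal `κ`: the representable functor
`A(X, -)` preserves `κ`-filtered colimits of `M`-subobjects. -/
def HasRankLE (M : MorphismProperty A) (κ : Cardinal.{v}) [Fact κ.IsRegular] (X : A) : Prop :=
  ∀ (J : Type v) [SmallCategory J] [IsCardinalFiltered J κ] (F : J ⥤ A),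
    IsDiagramOfSubobjects M F → PreservesColimit F (coyoneda.obj (Opposite.op X))

/-- The object `X` has a rank with respect to `M`. -/
def HasRank (M : MorphismProperty A) (X : A) : Prop :=
  ∃ (κ : Cardinal.{v}) (_ : Fact κ.IsRegular), HasRankLE M κ X

/-- The category `A` is locally ranked with respect to the proper orthogonal factorisation system
`(E, M)`. -/
structure IsLocallyRanked (E M : MorphismProperty A) : Prop where
  cocomplete : HasColimitsOfSize.{v, v} A
  proper : IsProperOFS E M
  cowellpowered : IsCowellpowered E
  hasRank (X : A) : HasRank M X

/-- The class of morphisms of `A^𝟚` with both components in `M`. -/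
def arrowClass (M : MorphismProperty A) : MorphismProperty (Arrow A) :=
  fun _ _ φ ↦ M φ.left ∧ M φ.right

end LocallyRanked

/-! ### Enriched algebraic weak factorisation systems -/

/-- The axioms of a mixed distributive law of a comonad `G` over a monad `T`, for a natural
transformation with components `G (T X) ⟶ T (G X)`. -/
structure IsMixedDistributiveLaw {A : Type u} [Category.{v} A] (G : Comonad A) (T : Monad A)
    (δ : T.toFunctor ⋙ G.toFunctor ⟶ G.toFunctor ⋙ T.toFunctor) : Prop where
  unit (X : A) : G.map (T.η.app X) ≫ δ.app X = T.η.app (G.obj X)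
  counit (X : A) : δ.app X ≫ T.map (G.ε.app X) = G.ε.app (T.obj X)
  mult (X : A) : G.map (T.μ.app X) ≫ δ.app X =
    δ.app (T.obj X) ≫ T.map (δ.app X) ≫ T.μ.app (G.obj X)
  comult (X : A) : δ.app X ≫ T.map (G.δ.app X) =
    G.δ.app (T.obj X) ≫ G.map (δ.app X) ≫ δ.app (G.obj X)

section AWFS

variable (V : Type u') [Category.{v'} V] [MonoidalCategory V] [HasPullbacks V]
variable (C : Type u) [Category.{v} C] [EnrichedOrdinaryCategory V C]

/-- A `V`-functorial factorisation `f = ρ_f ∘ λ_f` through `K f`. -/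
structure EnrichedFactorisation where
  K : Arrow C ⥤ C
  enr : FunctorEnrichment V K
  lam : Arrow.leftFunc ⟶ K
  rho : K ⟶ Arrow.rightFunc
  lam_natural : (domEnrichment V).IsNatural enr lam
  rho_natural : enr.IsNatural (codEnrichment V) rho
  fac (f : Arrow C) : lam.app f ≫ rho.app f = f.hom

namespace EnrichedFactorisation

variable {V C}
variable (F : EnrichedFactorisation V C)

/-- The endofunctor `f ↦ λ_f` of `C^𝟚`. -/
abbrev L : Arrow C ⥤ Arrow C := toArrow F.lam

/-- The endofunctor `f ↦ ρ_f` of `C^𝟚`. -/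
abbrev R : Arrow C ⥤ Arrow C := toArrow F.rho

/-- `L` is a `V`-functor. -/
def enrL : FunctorEnrichment V F.L := toArrowEnrichment _ _ _ F.lam_natural

/-- `R` is a `V`-functor. -/
def enrR : FunctorEnrichment V F.R := toArrowEnrichment _ _ _ F.rho_natural

/-- The copoint `Φ_f = (1, ρ_f) : L f ⟶ f`. -/
def Phi : F.L ⟶ 𝟭 (Arrow C) where
  app f := Arrow.homMk (𝟙 f.left) (F.rho.app f)
    (show 𝟙 f.left ≫ f.hom = F.lam.app f ≫ F.rho.app f by rw [F.fac, id_comp])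
  naturality f g φ := by
    apply Arrow.hom_ext
    · change φ.left ≫ 𝟙 g.left = 𝟙 f.left ≫ φ.left
      rw [id_comp, comp_id]
    · exact F.rho.naturality φ

/-- The point `Λ_f = (λ_f, 1) : f ⟶ R f`. -/
def Lam : 𝟭 (Arrow C) ⟶ F.R where
  app f := Arrow.homMk (F.lam.app f) (𝟙 f.right)
    (show F.lam.app f ≫ F.rho.app f = f.hom ≫ 𝟙 f.right by rw [F.fac, comp_id])
  naturality f g φ := by
    apply Arrow.hom_ext
    · exact F.lam.naturality φ
    · change φ.right ≫ 𝟙 g.right = 𝟙 f.right ≫ φ.right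
      rw [id_comp, comp_id]

end EnrichedFactorisation

/-- A `V`-functorial factorisation with a comultiplication making `L` a `V`-comonad and a
multiplication making `R` a `V`-monad. -/
structure EnrichedPreAWFS extends EnrichedFactorisation V C where
  Sig : toEnrichedFactorisation.L ⟶ toEnrichedFactorisation.L ⋙ toEnrichedFactorisation.L
  Pi : toEnrichedFactorisation.R ⋙ toEnrichedFactorisation.R ⟶ toEnrichedFactorisation.R
  Sig_natural : toEnrichedFactorisation.enrL.IsNatural
    (toEnrichedFactorisation.enrL.comp toEnrichedFactorisation.enrL) Sig
  Pi_natural : (toEnrichedFactorisation.enrR.comp toEnrichedFactorisation.enrR).IsNatural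
    toEnrichedFactorisation.enrR Pi
  coassoc (f : Arrow C) : Sig.app f ≫ toEnrichedFactorisation.L.map (Sig.app f) =
    Sig.app f ≫ Sig.app (toEnrichedFactorisation.L.obj f)
  left_counit (f : Arrow C) : Sig.app f ≫
    toEnrichedFactorisation.Phi.app (toEnrichedFactorisation.L.obj f) = 𝟙 _
  right_counit (f : Arrow C) : Sig.app f ≫
    toEnrichedFactorisation.L.map (toEnrichedFactorisation.Phi.app f) = 𝟙 _
  assoc (f : Arrow C) : toEnrichedFactorisation.R.map (Pi.app f) ≫ Pi.app f =
    Pi.app (toEnrichedFactorisation.R.obj f) ≫ Pi.app f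
  left_unit (f : Arrow C) :
    toEnrichedFactorisation.Lam.app (toEnrichedFactorisation.R.obj f) ≫ Pi.app f = 𝟙 _
  right_unit (f : Arrow C) :
    toEnrichedFactorisation.R.map (toEnrichedFactorisation.Lam.app f) ≫ Pi.app f = 𝟙 _

namespace EnrichedPreAWFS

variable {V C}
variable (S : EnrichedPreAWFS V C)

/-- The comonad `𝖫` on `C^𝟚`. -/
def comonad : Comonad (Arrow C) where
  toFunctor := S.L
  ε := S.Phi
  δ := S.Sig
  coassoc := S.coassoc
  left_counit := S.left_counit
  right_counit := S.right_counit

/-- The monad `𝖱` on `C^𝟚`. -/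
def monad : Monad (Arrow C) where
  toFunctor := S.R
  η := S.Lam
  μ := S.Pi
  assoc := S.assoc
  left_unit := S.left_unit
  right_unit := S.right_unit

/-- The component `σ_f : K f ⟶ K (L f)` of the comultiplication `Σ_f = (1, σ_f)`. -/
def sigma (f : Arrow C) : S.K.obj f ⟶ S.K.obj (S.L.obj f) := (S.Sig.app f).right

/-- The component `π_f : K (R f) ⟶ K f` of the multiplication `Π_f = (π_f, 1)`. -/
def pi (f : Arrow C) : S.K.obj (S.R.obj f) ⟶ S.K.obj f := (S.Pi.app f).left

lemma Pi_right (f : Arrow C) : (S.Pi.app f).right = 𝟙 f.right :=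
  (id_comp (X := f.right) (Y := f.right) (S.Pi.app f).right).symm.trans
    (congrArg (fun φ ↦ φ.right) (S.left_unit f))

lemma sigma_rho (f : Arrow C) : S.sigma f ≫ S.rho.app (S.L.obj f) = 𝟙 (S.K.obj f) :=
  congrArg (fun φ ↦ φ.right) (S.left_counit f)

lemma lam_pi (f : Arrow C) : S.lam.app (S.R.obj f) ≫ S.pi f = 𝟙 (S.K.obj f) :=
  congrArg (fun φ ↦ φ.left) (S.left_unit f)

lemma pi_rho (f : Arrow C) : S.pi f ≫ S.rho.app f = S.rho.app (S.R.obj f) := by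
  have h : S.pi f ≫ S.rho.app f = S.rho.app (S.R.obj f) ≫ (S.Pi.app f).right :=
    Arrow.w (S.Pi.app f)
  rw [h, Pi_right]
  exact comp_id _

/-- The natural transformation `LR ⟶ RL` with components `(σ_f, π_f)`. -/
def Delta : S.monad.toFunctor ⋙ S.comonad.toFunctor ⟶
    S.comonad.toFunctor ⋙ S.monad.toFunctor where
  app f := Arrow.homMk (f := S.L.obj (S.R.obj f)) (g := S.R.obj (S.L.obj f)) (S.sigma f) (S.pi f)
    ((S.sigma_rho f).trans (S.lam_pi f).symm)
  naturality f g φ := by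
    apply Arrow.hom_ext
    · exact congrArg (fun φ ↦ φ.right) (S.Sig.naturality φ)
    · exact congrArg (fun φ ↦ φ.left) (S.Pi.naturality φ)

end EnrichedPreAWFS

/-- A `V`-enriched algebraic weak factorisation system on the `V`-category `C`. -/
structure EnrichedAWFS extends EnrichedPreAWFS V C where
  distributive : IsMixedDistributiveLaw toEnrichedPreAWFS.comonad toEnrichedPreAWFS.monad
    toEnrichedPreAWFS.Delta

namespace EnrichedAWFS

variable {V C}
variable (S : EnrichedAWFS V C)

/-- The left class of the underlying weak factorisation system: the morphisms that admit
a coalgebra structure `(1, s) : f ⟶ L f` for the copointed endofunctor `(L, Φ)`. -/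
def leftClass : MorphismProperty C := fun _ Y f ↦
  ∃ s : Y ⟶ S.K.obj (Arrow.mk f),
    f ≫ s = S.lam.app (Arrow.mk f) ∧ s ≫ S.rho.app (Arrow.mk f) = 𝟙 Y

/-- The right class of the underlying weak factorisation system: the morphisms that admit
an algebra structure `(p, 1) : R f ⟶ f` for the pointed endofunctor `(R, Λ)`. -/
def rightClass : MorphismProperty C := fun X _ f ↦
  ∃ p : S.K.obj (Arrow.mk f) ⟶ X,
    S.lam.app (Arrow.mk f) ≫ p = 𝟙 X ∧ p ≫ f = S.rho.app (Arrow.mk f)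

/-- The underlying weak factorisation system `(ℒ, ℛ)` is cofibrantly generated by the class `I` of
morphisms: `ℛ` consists of the morphisms with the right lifting property with respect to `I`, and
`ℒ` of those with the left lifting property with respect to `ℛ`. -/
def IsCofibrantlyGeneratedBy (I : MorphismProperty C) : Prop :=
  S.rightClass = I.rlp ∧ S.leftClass = I.rlp.llp

/-- A morphism of `C/B`, as a commutative square whose codomain component is the identity. -/
def overSquare {B : C} {X Y : Over B} (φ : X ⟶ Y) : Arrow.mk X.hom ⟶ Arrow.mk Y.hom :=
  Arrow.homMk (f := Arrow.mk X.hom) (g := Arrow.mk Y.hom) φ.left (𝟙 B)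
    ((Over.w φ).trans (comp_id X.hom).symm)

/-- The restriction of the codomain-preserving monad `𝖱` to the fibre `C/B`. -/
def fibreMonad (B : C) : Monad (Over B) where
  obj X := Over.mk (Y := S.K.obj (Arrow.mk X.hom)) (S.rho.app (Arrow.mk X.hom))
  map {X Y} φ := Over.homMk (U := Over.mk (Y := S.K.obj (Arrow.mk X.hom)) _)
    (V := Over.mk (Y := S.K.obj (Arrow.mk Y.hom)) _)
    (S.K.map (overSquare φ))
    ((S.rho.naturality (overSquare φ)).trans (comp_id (S.rho.app (Arrow.mk X.hom))))
  map_id X := by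
    ext
    exact S.K.map_id (Arrow.mk X.hom)
  map_comp {X Y Z} φ ψ := by
    ext
    have h : overSquare (φ ≫ ψ) = overSquare φ ≫ overSquare ψ := by
      apply Arrow.hom_ext
      · rfl
      · exact (comp_id (𝟙 B)).symm
    change S.K.map (overSquare (φ ≫ ψ)) = S.K.map (overSquare φ) ≫ S.K.map (overSquare ψ)
    rw [h, S.K.map_comp]
  η :=
    { app := fun X ↦ Over.homMk (S.lam.app (Arrow.mk X.hom)) (S.fac (Arrow.mk X.hom))
      naturality := fun X Y φ ↦ by
        ext
        exact S.lam.naturality (overSquare φ) }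
  μ :=
    { app := fun X ↦ Over.homMk (S.pi (Arrow.mk X.hom)) (S.pi_rho (Arrow.mk X.hom))
      naturality := fun X Y φ ↦ by
        ext
        exact congrArg (fun ψ ↦ ψ.left) (S.Pi.naturality (overSquare φ)) }
  assoc X := by
    ext
    have h : overSquare (B := B) (X := Over.mk (Y := S.K.obj (S.R.obj (Arrow.mk X.hom)))
        (S.rho.app (S.R.obj (Arrow.mk X.hom))))
        (Y := Over.mk (Y := S.K.obj (Arrow.mk X.hom)) (S.rho.app (Arrow.mk X.hom)))
        (Over.homMk (S.pi (Arrow.mk X.hom)) (S.pi_rho (Arrow.mk X.hom))) =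
        S.Pi.app (Arrow.mk X.hom) := by
      apply Arrow.hom_ext
      · rfl
      · exact (S.Pi_right (Arrow.mk X.hom)).symm
    refine Eq.trans ?_ (congrArg (fun ψ ↦ ψ.left) (S.assoc (Arrow.mk X.hom)))
    exact congrArg (fun ψ ↦ S.K.map ψ ≫ S.pi (Arrow.mk X.hom)) h
  left_unit X := by
    ext
    exact S.lam_pi (Arrow.mk X.hom)
  right_unit X := by
    ext
    exact congrArg (fun ψ ↦ ψ.left) (S.right_unit (Arrow.mk X.hom))

/-- The fibrant replacement monad `𝖱₁`, on `C/1 ≅ C`, where `1` is the terminal object. -/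
abbrev fibrantReplacement {one : C} (_ : IsTerminal one) : Monad (Over one) :=
  S.fibreMonad one

/-- The object `X` is fibrant for the underlying weak factorisation system: the morphism from `X`
to the terminal object is in the right class. -/
def IsFibrant {one : C} (h : IsTerminal one) (X : C) : Prop :=
  S.rightClass (h.from X)

end EnrichedAWFS

end AWFS

end

section

variable {C : Type u} [Category.{v} C]

/-! Fibrancy is tested by lifting: since `𝓡` is the class of morphisms with the right lifting
property against `I`, an object `X` is fibrant exactly when `X ⟶ 1` lifts against every `i` in `I`.

The argument is the compactness step of the small object argument, run in the arrow category. A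
lifting problem from `i` to `colim X_j ⟶ 1` is a morphism `i ⟶ (colim X_j ⟶ 1)` of `C^𝟚`. A filtered
category is connected, so the constant diagram at `1` has colimit `1`, and `colim X_j ⟶ 1` is the
colimit in `C^𝟚` of the arrows `X_j ⟶ 1` (`isColimitMapCoconeArrowToTerminal`). As `i` has rank, the
square factors through some `X_j ⟶ 1`. It has a filler there because `X_j`, being an algebra, is
fibrant (`EnrichedAWFS.isFibrant_of_algebra`). Composing this filler with `X_j ⟶ colim X_j` solves
the original problem (`hasLiftingProperty_from_of_isColimit`).

The cardinal `κ` has to bound the ranks of all members of `I` at once; it exists because `I` is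
small (`exists_hasRankLE_of_small`). -/

/-- The functor that sends an object `X` to the arrow from `X` to the terminal object. -/
def arrowToTerminal {one : C} (h : IsTerminal one) : C ⥤ Arrow C where
  obj X := Arrow.mk (h.from X)
  map f := Arrow.homMk f (𝟙 one) (h.hom_ext _ _)

/-- The functor `X ↦ (X ⟶ 1)` preserves connected colimits. -/
noncomputable def isColimitMapCoconeArrowToTerminal {one : C} (h : IsTerminal one) {J : Type w} [Category.{v'} J]
    [IsConnected J] {F : J ⥤ C} {c : Cocone F} (hc : IsColimit c) :
    IsColimit ((arrowToTerminal h).mapCocone c) :=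
  -- Colimits of arrows are detected on domains and codomains separately. The domain part is the
  -- given colimit; the codomain part is the constant cocone at `one`, which is colimiting because
  -- `J` is connected.
  Comma.fstSndJointlyReflectColimit
    (hc : IsColimit ((Comma.fst _ _).mapCocone ((arrowToTerminal h).mapCocone c)))
    (isColimitConstCocone J one :
      IsColimit ((Comma.snd _ _).mapCocone ((arrowToTerminal h).mapCocone c)))

/-- The codomain components of the image cocone are identities of `one`, which is why `M` must
contain identities. This makes the rank of an arrow applicable to the diagram of the `X_j ⟶ 1`. -/
lemma IsDiagramOfSubobjects.comp_arrowToTerminal {one : C} (h : IsTerminal one)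
    {M : MorphismProperty C} [M.ContainsIdentities] {J : Type w} [Category.{v'} J] {F : J ⥤ C}
    (hF : IsDiagramOfSubobjects M F) :
    IsDiagramOfSubobjects (arrowClass M) (F ⋙ arrowToTerminal h) := by
  obtain ⟨s, hs⟩ := hF
  exact ⟨(arrowToTerminal h).mapCocone s, fun j ↦ ⟨hs j, M.id_mem one⟩⟩

/-! ### Uniform rank for small families -/

/-- For `κ ≤ κ'`, a `κ'`-filtered category is already `κ`-filtered, so a larger cardinal leaves
fewer diagrams to check. -/
lemma HasRankLE.of_le {M : MorphismProperty C} {κ κ' : Cardinal.{v}} [Fact κ.IsRegular]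
    [Fact κ'.IsRegular] (hκ : κ ≤ κ') {X : C} (hX : HasRankLE M κ X) : HasRankLE M κ' X := by
  intro J _ _ F hF
  have := IsCardinalFiltered.of_le J hκ
  exact hX J F hF

/-- A small family of objects with rank has a common rank. -/
lemma exists_hasRankLE_of_small {M : MorphismProperty C} {ι : Type w} [Small.{v} ι] (X : ι → C)
    (hX : ∀ i, HasRank M (X i)) :
    ∃ (κ : Cardinal.{v}) (_ : Fact κ.IsRegular), ∀ i, HasRankLE M κ (X i) := by
  choose κ hκ h using hX
  -- The supremum runs over `Shrink ι` to stay in universe `v`. The maximum with `ℵ₀` makes the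
  -- successor of `s` regular, which a mere supremum of regular cardinals need not be.
  let s : Cardinal.{v} := max Cardinal.aleph0 (⨆ i : Shrink.{v} ι, κ ((equivShrink ι).symm i))
  have hs (i : ι) : κ i ≤ Order.succ s := by
    refine le_trans ?_ ((le_max_right _ _).trans (Order.le_succ s))
    simpa using le_ciSup (Cardinal.bddAbove_of_small (s := Set.range
      fun i : Shrink.{v} ι ↦ κ ((equivShrink ι).symm i))) (equivShrink ι i)
  have : Fact (Order.succ s).IsRegular := ⟨Cardinal.isRegular_succ (le_max_left _ _)⟩
  exact ⟨Order.succ s, this, fun i ↦ (h i).of_le (hs i)⟩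

/-! ### Lifting against an arrow with rank -/

/-- If the arrow `i` has rank at most `κ`, then the objects `X` for which `X ⟶ 1` has the right
lifting property with respect to `i` are closed under `κ`-filtered colimits of `M`-subobjects. -/
lemma hasLiftingProperty_from_of_isColimit {M : MorphismProperty C} [M.ContainsIdentities]
    {one : C} (h : IsTerminal one) {κ : Cardinal.{v}} [Fact κ.IsRegular] {A B : C} {i : A ⟶ B}
    (hi : HasRankLE (arrowClass M) κ (Arrow.mk i)) {J : Type v} [SmallCategory J]
    [IsCardinalFiltered J κ] {F : J ⥤ C} (hF : IsDiagramOfSubobjects M F)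
    (hlift : ∀ j, HasLiftingProperty i (h.from (F.obj j))) {c : Cocone F} (hc : IsColimit c) :
    HasLiftingProperty i (h.from c.pt) := by
  have := isFiltered_of_isCardinalFiltered J κ
  have : IsConnected J := IsFiltered.isConnected J
  have := hi J _ (hF.comp_arrowToTerminal h)
  refine ⟨fun {a b} sq ↦ ?_⟩
  -- The square is an element of the hom-set from `i` into a colimit in `C^𝟚`. The hom-functor of
  -- `i` preserves this colimit, so the element comes from some stage `j`.
  obtain ⟨j, φ, hφ⟩ := Types.jointly_surjective _
    (isColimitOfPreserves (coyoneda.obj (Opposite.op (Arrow.mk i)))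
      (isColimitMapCoconeArrowToTerminal h hc)) (Arrow.homMk a b sq.w)
  let φ' : Arrow.mk i ⟶ Arrow.mk (h.from (F.obj j)) := φ
  have ha : φ'.left ≫ c.ι.app j = a := congrArg (fun ψ : Arrow.mk i ⟶ _ ↦ ψ.left) hφ
  have := hlift j
  have sq' : CommSq φ'.left i (h.from (F.obj j)) φ'.right := ⟨Arrow.w φ'⟩
  -- Only the upper triangle needs the factorisation through stage `j`; the lower one ends in the
  -- terminal object.
  exact ⟨⟨{ l := sq'.lift ≫ c.ι.app j
            fac_left := by rw [sq'.fac_left_assoc, ha]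
            fac_right := h.hom_ext _ _ }⟩⟩

end

/-! ### Algebras are fibrant -/

/-- The structure map of an algebra on `C/1` is a map `K (X ⟶ 1) ⟶ X` over `1`. Its unit law and its
compatibility with the maps to `1` are the two equations of an algebra for the pointed endofunctor
`(R, Λ)`. -/
lemma EnrichedAWFS.isFibrant_of_algebra {V : Type u'} [Category.{v'} V] [MonoidalCategory V]
    [HasPullbacks V] {C : Type u} [Category.{v} C] [EnrichedOrdinaryCategory V C]
    (S : EnrichedAWFS V C) {one : C} (h : IsTerminal one)
    (X : (S.fibrantReplacement h).Algebra) : S.IsFibrant h X.A.left := by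
  have e : h.from X.A.left = X.A.hom := h.hom_ext _ _
  rw [IsFibrant, e]
  exact ⟨X.a.left, congrArg (fun φ ↦ φ.left) X.unit, Over.w X.a⟩

theorem mainTheorem9 (P : ObjectProperty Cat.{v, v}) [IsEnrichmentBase P]
    (C : Type u) [Category.{v} C] [EnrichedOrdinaryCategory P.FullSubcategory C]
    (hC : IsEnrichedCocomplete.{v} P.FullSubcategory C)
    (E M : MorphismProperty C) (hEM : IsLocallyRanked E M)
    {one : C} (hone : IsTerminal one)
    (S : EnrichedAWFS P.FullSubcategory C)
    (I : MorphismProperty C) (hI : MorphismProperty.IsSmall.{v} I)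
    (hrank : ∀ ⦃X Y : C⦄ (f : X ⟶ Y), I f → HasRank (arrowClass M) (Arrow.mk f))
    (hgen : S.IsCofibrantlyGeneratedBy I) :
    ∃ (κ : Cardinal.{v}) (_ : Fact κ.IsRegular),
      ∀ (J : Type v) [SmallCategory J] [IsCardinalFiltered J κ]
        (D : J ⥤ (S.fibrantReplacement hone).Algebra)
        (_ : IsDiagramOfSubobjects M
          (D ⋙ (S.fibrantReplacement hone).forget ⋙ Over.forget one))
        (c : Cocone (D ⋙ (S.fibrantReplacement hone).forget ⋙ Over.forget one))
        (_ : IsColimit c),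
        S.IsFibrant hone c.pt := by
  -- `M` is the class of morphisms with the right lifting property against `E`, and identities have
  -- every right lifting property.
  have : M.ContainsIdentities := by
    rw [← hEM.proper.wfs.rlp]
    infer_instance
  -- Smallness of `I` enters here: one `κ` is chosen for all generators before any diagram is given.
  obtain ⟨κ, hκ, hI'⟩ := exists_hasRankLE_of_small (fun i : I.toSet ↦ i.1)
    fun i ↦ hrank i.1.hom i.2
  refine ⟨κ, hκ, fun J _ _ D hD c hc ↦ ?_⟩
  have hfib (X : C) : S.IsFibrant hone X ↔ I.rlp (hone.from X) := by
    rw [← hgen.1, EnrichedAWFS.IsFibrant]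
  rw [hfib]
  intro A B i hi
  exact hasLiftingProperty_from_of_isColimit hone (hI' ⟨Arrow.mk i, hi⟩) hD
    (fun j ↦ (hfib _).1 (S.isFibrant_of_algebra hone (D.obj j)) i hi) hc
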